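/- All graphs are finite and simple. For a graph $G$ and a vertex $x$ let $N_G(x)$ be the set of neighbours of $x$ and $N_G[x]=N_G(x)\cup\{x\}$. For $n\in\mathbb{N}$ let $\chi'_{CF}(n)$ be the smallest integer $k\ge 0$ such that for every $n$-vertex graph $G$ without isolated vertices there is a family $\mathcal F\subseteq 2^{V(G)}$ of vertex subsets, not necessarily disjoint, with $|\mathcal F|\le k$, such that for every $x\in V(G)$ there is $F\in\mathcal F$ with $|N_G(x)\cap F|=1$. Let $\chi'_{CF}[n]$ be the smallest integer $k\ge 0$ such that for every $n$-vertex graph $G$ (isolated vertices allowed) there is a family $\mathcal F\subseteq 2^{V(G)}$ of vertex subsets, not necessarily disjoint, with $|\mathcal F|\le k$, such that for every $x\in V(G)$ there is $F\in\mathcal F$ with $|N_G[x]\cap F|=1$. Then, as $n\to\infty$, $$\chi'_{CF}(n)=\Theta(\ln^2 n)\qquad\text{and}\qquad \chi'_{CF}[n]=\Theta(\ln^2 n),$$ that is, each of these quantities lies between $c\ln^2 n$ and $C\ln^2 n$ for all sufficiently large $n$, for some absolute constants $0<c\le C$. -/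

import Mathlib

open Filter Asymptotics

/-- `F` is a conflict-free family for `G` with respect to open neighbourhoods:
every vertex has exactly one neighbour in some member of `F`.  The members of `F` are arbitrary
vertex subsets; they need not be disjoint. -/
def IsOpenCFFamily {V : Type*} (G : SimpleGraph V) (F : Finset (Set V)) : Prop :=
  ∀ x : V, ∃ S ∈ F, (G.neighborSet x ∩ S).ncard = 1

/-- `F` is a conflict-free family for `G` with respect to closed neighbourhoods
`N[x] = {x} ∪ N(x)`. -/
def IsClosedCFFamily {V : Type*} (G : SimpleGraph V) (F : Finset (Set V)) : Prop :=
  ∀ x : V, ∃ S ∈ F, (insert x (G.neighborSet x) ∩ S).ncard = 1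

/-- The numbers `k` such that every `n`-vertex graph without isolated vertices has an
(open-neighbourhood) conflict-free family of at most `k` sets.  A graph with an isolated vertex
has no such family of any size. -/
def openCFBounds (n : ℕ) : Set ℕ :=
  {k | ∀ G : SimpleGraph (Fin n), (∀ x, ∃ y, G.Adj x y) →
    ∃ F : Finset (Set (Fin n)), F.card ≤ k ∧ IsOpenCFFamily G F}

/-- The numbers `k` such that every `n`-vertex graph has a closed-neighbourhood conflict-free
family of at most `k` sets. -/
def closedCFBounds (n : ℕ) : Set ℕ :=
  {k | ∀ G : SimpleGraph (Fin n),
    ∃ F : Finset (Set (Fin n)), F.card ≤ k ∧ IsClosedCFFamily G F}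

/-- The smallest element of `openCFBounds n`. -/
noncomputable def chiCFOpen (n : ℕ) : ℕ := sInf (openCFBounds n)

/-- The smallest element of `closedCFBounds n`. -/
noncomputable def chiCFClosed (n : ℕ) : ℕ := sInf (closedCFBounds n)

/-- The minimum is attained, so the junk value of `sInf ∅` never occurs. -/
theorem chiCFOpen_isLeast (n : ℕ) : IsLeast (openCFBounds n) (chiCFOpen n) := by
  classical
  have h : (openCFBounds n).Nonempty := by
    refine ⟨(Finset.univ : Finset (Set (Fin n))).card, fun G hG => ⟨Finset.univ, le_rfl, ?_⟩⟩
    intro x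
    obtain ⟨y, hy⟩ := hG x
    refine ⟨{y}, Finset.mem_univ _, ?_⟩
    rw [Set.inter_eq_right.2 (Set.singleton_subset_iff.2 ((G.mem_neighborSet x y).2 hy)), Set.ncard_singleton]
  exact ⟨Nat.sInf_mem h, fun k hk => Nat.sInf_le hk⟩

/-- The minimum is attained, so the junk value of `sInf ∅` never occurs. -/
theorem chiCFClosed_isLeast (n : ℕ) : IsLeast (closedCFBounds n) (chiCFClosed n) := by
  classical
  have h : (closedCFBounds n).Nonempty := by
    refine ⟨(Finset.univ : Finset (Set (Fin n))).card, fun G => ⟨Finset.univ, le_rfl, ?_⟩⟩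
    intro x
    refine ⟨{x}, Finset.mem_univ _, ?_⟩
    rw [Set.inter_eq_right.2 (Set.singleton_subset_iff.2 (Set.mem_insert _ _)),
      Set.ncard_singleton]
  exact ⟨Nat.sInf_mem h, fun k hk => Nat.sInf_le hk⟩

/-!
Upper bound: a random set of density about `1 / s` meets a set of size about `s` in exactly one
point with probability bounded below. For each of the `O(log n)` dyadic ranges of sizes, `O(log n)`
sets chosen greedily therefore handle all neighbourhoods with size in that range.

Lower bound: give the vertices weights `2 ^ -1, …, 2 ^ -L`, with `L` of order `log n` and every
weight shared by many vertices, and join `x` and `y` with probability the product of their weights.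
Given `t` sets, a vertex of weight `2 ^ -(i + 1)` fails to be served if its neighbourhood misses
the sets that are light at scale `2 ^ i` and hits the heavy ones at least twice. Absorbing sets of
weight at most a multiple of `2 ^ i` into a growing set `U` shows that, summed over the scales, the
costs in the exponent are `O(t)`. At some scale the cost is therefore `O(t / L)`, and by the
Harris–FKG inequality each vertex of that weight is unserved with probability `exp (-O(t / L))`.
These events are independent over the vertices outside the given sets, so it suffices to take a
union bound over families of `t` sets, truncated to a common size `M` to keep their number small:
a set with at least `M` elements is heavy at every scale, so that an `M`-element subset of it
already serves the purpose. For `t` a small multiple of `L ^ 2` the union bound leaves a graph with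
no conflict-free family of `t` sets. Open and closed neighbourhoods agree on sets that avoid `x`.
-/

open MeasureTheory ProbabilityTheory unitInterval

theorem exp_neg_two_mul_le_one_sub {x : ℝ} (hx0 : 0 ≤ x) (hx : x ≤ 1 / 2) :
    Real.exp (-(2 * x)) ≤ 1 - x := by
  rw [Real.exp_neg, inv_le_comm₀ (Real.exp_pos _) (by linarith)]
  refine le_trans ?_ (Real.add_one_le_exp (2 * x))
  rw [inv_le_iff_one_le_mul₀ (by linarith)]
  nlinarith

theorem pow_mul_one_sub_pow_lt_one {n k m : ℕ} {δ : ℝ} (hn : 0 < n) (hδ : δ ≤ 1)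
    (hlog : k * Real.log n < m * δ) : (n : ℝ) ^ k * (1 - δ) ^ m < 1 :=
  calc (n : ℝ) ^ k * (1 - δ) ^ m ≤ (n : ℝ) ^ k * Real.exp (-δ) ^ m := by
        gcongr
        exact Real.one_sub_le_exp_neg δ
    _ = Real.exp (k * Real.log n - m * δ) := by
        rw [← Real.exp_nat_mul, mul_neg, sub_eq_add_neg, Real.exp_add, Real.exp_nat_mul,
          Real.exp_log (mod_cast hn)]
    _ < 1 := Real.exp_lt_one_iff.2 (sub_neg.2 hlog)

section RandomSet

open scoped Classical

variable {E : Type*}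

/-- The law of a random set that contains each `e` independently with probability `p e`. -/
noncomputable def randomSet (p : E → I) : Measure (Set E) :=
  (Measure.infinitePi fun e => bernoulliMeasure True False (p e)).map MeasurableEquiv.setOfPred

instance (p : E → I) : IsProbabilityMeasure (randomSet p) :=
  Measure.isProbabilityMeasure_map MeasurableEquiv.setOfPred.measurable.aemeasurable

theorem exp_neg_two_mul_sum_le_prod_one_sub {p : E → I} {U : Finset E}
    (hp : ∀ e ∈ U, (p e : ℝ) ≤ 1 / 2) :
    Real.exp (-(2 * ∑ e ∈ U, (p e : ℝ))) ≤ ∏ e ∈ U, (1 - (p e : ℝ)) := by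
  rw [Finset.mul_sum, ← Finset.sum_neg_distrib, Real.exp_sum]
  exact Finset.prod_le_prod (fun _ _ => (Real.exp_pos _).le)
    fun e he => exp_neg_two_mul_le_one_sub (p e).2.1 (hp e he)

theorem map_preimage_randomSet [Finite E] {E' : Type*} (p : E → I) {g : E' → E} (hg : g.Injective) :
    (randomSet p).map (g ⁻¹' ·) = randomSet (p ∘ g) := by
  have hmap := Measure.map_infinitePi_infinitePi_of_inj
    (P := fun e => bernoulliMeasure True False (p e)) hg
  simp only [randomSet, Function.comp_apply, ← hmap]
  rw [Measure.map_map .of_discrete (by fun_prop), Measure.map_map (by fun_prop) (by fun_prop)]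
  rfl

theorem integral_randomSet_prod [Finite E] (p : E → I) (F : Finset E) (a b : E → ℝ) :
    ∫ S, ∏ e ∈ F, (if e ∈ S then a e else b e) ∂randomSet p
      = ∏ e ∈ F, (p e * a e + (1 - p e) * b e) := by
  have := Fintype.ofFinite E
  have key := integral_fintype_prod_eq_prod (μ := fun e => bernoulliMeasure True False (p e))
    fun e (P : Prop) => if e ∈ F then (if P then a e else b e) else 1
  have hfactor (e : E) : ∫ P, (if e ∈ F then (if P then a e else b e) else 1)
      ∂bernoulliMeasure True False (p e)
      = if e ∈ F then p e * a e + (1 - p e) * b e else 1 := by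
    split_ifs <;> simp [integral_bernoulliMeasure]
  simp only [hfactor, Finset.prod_ite_mem, Finset.univ_inter] at key
  rw [randomSet, integral_map_equiv, Measure.infinitePi_eq_pi]
  exact key

theorem randomSet_real_forall_mem_iff [Finite E] (p : E → I) (F : Finset E) (T : Set E) :
    (randomSet p).real {S | ∀ e ∈ F, e ∈ S ↔ e ∈ T}
      = ∏ e ∈ F, (if e ∈ T then (p e : ℝ) else 1 - p e) := by
  have key := integral_randomSet_prod p F (fun e => if e ∈ T then 1 else 0)
    (fun e => if e ∈ T then 0 else 1)
  have hlhs : {S | ∀ e ∈ F, e ∈ S ↔ e ∈ T}.indicator 1 = fun S : Set E =>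
      ∏ e ∈ F, if e ∈ S then if e ∈ T then (1 : ℝ) else 0 else if e ∈ T then 0 else 1 := by
    ext S
    have hfactor (e : E) : (if e ∈ S then if e ∈ T then (1 : ℝ) else 0 else if e ∈ T then 0 else 1)
        = if (e ∈ S ↔ e ∈ T) then 1 else 0 := by split_ifs <;> simp_all
    simp only [hfactor, Finset.prod_ite_zero, Finset.prod_const_one, Set.indicator_apply,
      Set.mem_ofPred_eq, Pi.one_apply]
  rw [← integral_indicator_one .of_discrete, hlhs, key]
  exact Finset.prod_congr rfl fun e _ => by split_ifs <;> simp

theorem randomSet_real_singleton [Fintype E] (p : E → I) (T : Set E) :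
    (randomSet p).real {T} = ∏ e, (if e ∈ T then (p e : ℝ) else 1 - p e) := by
  rw [← randomSet_real_forall_mem_iff]
  simp [← Set.ext_iff]

theorem randomSet_real_eq_sum [Fintype E] (p : E → I) (𝒜 : Set (Set E)) :
    (randomSet p).real 𝒜 = ∑ S, (randomSet p).real {S} * 𝒜.indicator 1 S := by
  rw [← integral_indicator_one .of_discrete, integral_fintype .of_finite]
  simp

theorem randomSet_real_forall_slice [Finite E] {X Z : Type*} [Fintype X] [Finite Z] (p : E → I)
    {g : X × Z → E} (hg : g.Injective) (𝒜 : X → Set (Set Z)) :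
    (randomSet p).real {S | ∀ x, {z | g (x, z) ∈ S} ∈ 𝒜 x}
      = ∏ x, (randomSet fun z => p (g (x, z))).real (𝒜 x) := by
  have := Fintype.ofFinite E
  have := Fintype.ofFinite Z
  have hcurry : (randomSet (p ∘ g)).map (fun S x => Prod.mk x ⁻¹' S)
      = Measure.pi fun x => randomSet fun z => p (g (x, z)) := by
    refine Measure.ext_of_singleton fun T => ?_
    have hpre : (fun (S : Set (X × Z)) x => Prod.mk x ⁻¹' S) ⁻¹' {T} = {{xz | xz.2 ∈ T xz.1}} := by
      ext S
      simp [funext_iff, Set.ext_iff]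
    rw [Measure.map_apply .of_discrete .of_discrete, hpre, Measure.pi_singleton]
    rw [← ENNReal.toReal_eq_toReal_iff' (by finiteness)
      (ENNReal.prod_ne_top fun x _ => measure_ne_top _ _), ENNReal.toReal_prod]
    simp only [← measureReal_def, randomSet_real_singleton, Fintype.prod_prod_type]
    rfl
  have hreal : (Measure.pi fun x => randomSet fun z => p (g (x, z))).real (Set.univ.pi 𝒜)
      = ∏ x, (randomSet fun z => p (g (x, z))).real (𝒜 x) := by
    rw [measureReal_def, Measure.pi_pi, ENNReal.toReal_prod]
    rfl
  rw [← hreal, ← hcurry, ← map_preimage_randomSet p hg,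
    map_measureReal_apply .of_discrete .of_discrete,
    map_measureReal_apply .of_discrete .of_discrete]
  congr 1
  ext S
  simp only [Set.mem_preimage, Set.mem_univ_pi]
  rfl

theorem randomSet_real_disjoint_and [Finite E] (p : E → I) (U : Finset E) (𝒜 : Set (Set E)) :
    (randomSet p).real {S | Disjoint ↑U S ∧ S ∈ 𝒜}
      = (∏ e ∈ U, (1 - (p e : ℝ))) * (randomSet fun e => if e ∈ U then 0 else p e).real 𝒜 := by
  have := Fintype.ofFinite E
  rw [randomSet_real_eq_sum, randomSet_real_eq_sum, Finset.mul_sum]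
  refine Finset.sum_congr rfl fun S _ => ?_
  by_cases hS : Disjoint ↑U S
  · have hmass : (randomSet p).real {S} = (∏ e ∈ U, (1 - (p e : ℝ)))
        * (randomSet fun e => if e ∈ U then 0 else p e).real {S} := by
      have hU : ∏ e ∈ U, (1 - (p e : ℝ)) = ∏ e, if e ∈ U then 1 - (p e : ℝ) else 1 := by
        simp [Finset.prod_ite_mem]
      rw [randomSet_real_singleton, randomSet_real_singleton, hU, ← Finset.prod_mul_distrib]
      refine Finset.prod_congr rfl fun e _ => ?_
      by_cases heU : e ∈ U
      · simp [heU, Set.disjoint_left.1 hS (Finset.mem_coe.2 heU)]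
      · simp [heU]
    simp [hmass, hS, Set.indicator]
  · obtain ⟨e, heU, heS⟩ := Set.not_disjoint_iff.1 hS
    have hzero : (randomSet fun e => if e ∈ U then 0 else p e).real {S} = 0 := by
      rw [randomSet_real_singleton]
      exact Finset.prod_eq_zero (Finset.mem_univ e) (by simp_all)
    simp [hzero, hS]

theorem randomSet_real_mul_le_inter [Finite E] (p : E → I) {𝒜 ℬ : Set (Set E)} (h𝒜 : IsUpperSet 𝒜)
    (hℬ : IsUpperSet ℬ) :
    (randomSet p).real 𝒜 * (randomSet p).real ℬ ≤ (randomSet p).real (𝒜 ∩ ℬ) := by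
  have := Fintype.ofFinite E
  have hnn (𝒞 : Set (Set E)) : 0 ≤ 𝒞.indicator (1 : Set E → ℝ) :=
    fun S => Set.indicator_nonneg (fun _ _ => zero_le_one) S
  have hmono {𝒞 : Set (Set E)} (h : IsUpperSet 𝒞) : Monotone (𝒞.indicator (1 : Set E → ℝ)) := by
    intro S T hST
    by_cases hS : S ∈ 𝒞
    · simp [hS, h hST hS]
    · simpa [hS] using hnn 𝒞 T
  have hmul (S T : Set E) : (randomSet p).real {S} * (randomSet p).real {T}
      ≤ (randomSet p).real {S ⊓ T} * (randomSet p).real {S ⊔ T} := by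
    simp only [randomSet_real_singleton, ← Finset.prod_mul_distrib]
    refine (Finset.prod_congr rfl fun e _ => ?_).le
    by_cases hS : e ∈ S <;> by_cases hT : e ∈ T <;> simp [hS, hT, mul_comm]
  have key := fkg _ _ (fun S => (randomSet p).real {S}) (fun S => measureReal_nonneg) (hnn 𝒜)
    (hnn ℬ) (hmono h𝒜) (hmono hℬ) hmul
  have hone : ∑ S, (randomSet p).real {S} = 1 := by
    rw [sum_measureReal_singleton, Finset.coe_univ, probReal_univ]
  have hinter (S : Set E) : 𝒜.indicator (1 : Set E → ℝ) S * ℬ.indicator 1 S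
      = (𝒜 ∩ ℬ).indicator 1 S := by
    rw [Set.inter_indicator_one, Pi.mul_apply]
  simpa only [← randomSet_real_eq_sum, hone, one_mul, hinter] using key

theorem prod_randomSet_real_le_forall [Finite E] {ι : Type*} (p : E → I) (X : Finset ι)
    {𝒜 : ι → Set (Set E)} (h𝒜 : ∀ i, IsUpperSet (𝒜 i)) :
    ∏ i ∈ X, (randomSet p).real (𝒜 i) ≤ (randomSet p).real {S | ∀ i ∈ X, S ∈ 𝒜 i} := by
  induction X using Finset.induction_on with
  | empty => simp
  | insert i X hi ih =>
    have hupper : IsUpperSet {S | ∀ i ∈ X, S ∈ 𝒜 i} := fun S T hST hS j hj => h𝒜 j hST (hS j hj)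
    rw [Finset.prod_insert hi]
    refine (mul_le_mul_of_nonneg_left ih measureReal_nonneg).trans
      ((randomSet_real_mul_le_inter p (h𝒜 i) hupper).trans_eq ?_)
    congr 1
    ext S
    simp

theorem integral_half_pow_ncard_inter [Finite E] (p : E → I) (F : Finset E) :
    ∫ S, (1 / 2 : ℝ) ^ (↑F ∩ S).ncard ∂randomSet p = ∏ e ∈ F, (1 - (p e : ℝ) / 2) := by
  have key := integral_randomSet_prod p F (fun _ => 1 / 2) (fun _ => 1)
  convert key using 2 with S
  · ext S
    have hcoe : (↑F ∩ S : Set E) = ↑(F.filter (· ∈ S)) := by ext; simp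
    rw [hcoe, Set.ncard_coe_finset, Finset.prod_ite]
    simp
  · ring

theorem integral_half_pow_ncard_inter_le [Finite E] (p : E → I) (F : Finset E)
    (hF : 0 < ∑ e ∈ F, (p e : ℝ)) :
    ∫ S, (1 / 2 : ℝ) ^ (↑F ∩ S).ncard ∂randomSet p ≤ 2 / ∑ e ∈ F, (p e : ℝ) := by
  have hexp : ∏ e ∈ F, (1 - (p e : ℝ) / 2) ≤ Real.exp (-((∑ e ∈ F, (p e : ℝ)) / 2)) := by
    rw [Finset.sum_div, ← Finset.sum_neg_distrib, Real.exp_sum]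
    refine Finset.prod_le_prod (fun e _ => ?_) fun e _ => Real.one_sub_le_exp_neg _
    linarith [(p e).2.2]
  rw [integral_half_pow_ncard_inter]
  refine hexp.trans ?_
  rw [Real.exp_neg, inv_le_comm₀ (Real.exp_pos _) (by positivity), inv_div]
  linarith [Real.add_one_le_exp ((∑ e ∈ F, (p e : ℝ)) / 2)]

theorem exp_le_randomSet_real_two_le_ncard [Finite E] (p : E → I) (F : Finset E)
    (hF : 8 ≤ ∑ e ∈ F, (p e : ℝ)) :
    Real.exp (-(8 / ∑ e ∈ F, (p e : ℝ))) ≤ (randomSet p).real {S | 2 ≤ (↑F ∩ S).ncard} := by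
  set l := ∑ e ∈ F, (p e : ℝ)
  have hl : 0 < l := by linarith
  have hmarkov : 1 - (randomSet p).real {S | 2 ≤ (↑F ∩ S).ncard}
      ≤ 2 * ∫ S, (1 / 2 : ℝ) ^ (↑F ∩ S).ncard ∂randomSet p := by
    rw [← integral_const_mul, ← probReal_compl_eq_one_sub .of_discrete,
      ← integral_indicator_one .of_discrete]
    refine integral_mono .of_finite .of_finite fun S => ?_
    by_cases hS : 2 ≤ (↑F ∩ S).ncard
    · simp [hS]
    · have := pow_le_pow_of_le_one (by norm_num : (0 : ℝ) ≤ 1 / 2) (by norm_num)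
        (by omega : (↑F ∩ S).ncard ≤ 1)
      simp only [Set.indicator_apply, Set.mem_compl_iff, Set.mem_ofPred_eq, hS, not_false_eq_true,
        if_true, Pi.one_apply]
      linarith
  have hexp := exp_neg_two_mul_le_one_sub (x := 4 / l) (by positivity)
    (by rw [div_le_iff₀ hl]; linarith)
  have hbound := integral_half_pow_ncard_inter_le p F hl
  have h8 : 2 * (4 / l) = 8 / l := by ring
  have h4 : 2 * (2 / l) = 4 / l := by ring
  rw [h8] at hexp
  linarith

theorem exp_le_randomSet_real_disjoint_and_hits [Finite E] {ι : Type*} (p : E → I)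
    (hp : ∀ e, (p e : ℝ) ≤ 1 / 2) (U : Finset E) (X : Finset ι) (F : ι → Finset E)
    (hF : ∀ i ∈ X, 8 ≤ ∑ e ∈ F i \ U, (p e : ℝ)) :
    Real.exp (-(2 * ∑ e ∈ U, (p e : ℝ) + ∑ i ∈ X, 8 / ∑ e ∈ F i \ U, (p e : ℝ)))
      ≤ (randomSet p).real {S | Disjoint ↑U S ∧ ∀ i ∈ X, 2 ≤ (↑(F i) ∩ S).ncard} := by
  set q : E → I := fun e => if e ∈ U then 0 else p e
  have hq (i : ι) : ∑ e ∈ F i \ U, (p e : ℝ) = ∑ e ∈ F i, (q e : ℝ) := by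
    simp only [q, apply_ite Subtype.val]
    simp [Finset.sum_ite, Finset.sdiff_eq_filter]
  simp only [hq] at hF ⊢
  have hcond := randomSet_real_disjoint_and p U {S | ∀ i ∈ X, 2 ≤ (↑(F i) ∩ S).ncard}
  simp only [Set.mem_ofPred_eq] at hcond
  have hmiss := exp_neg_two_mul_sum_le_prod_one_sub (U := U) fun e _ => hp e
  rw [hcond, neg_add, Real.exp_add, ← Finset.sum_neg_distrib, Real.exp_sum X]
  have hhit : ∏ i ∈ X, Real.exp (-(8 / ∑ e ∈ F i, (q e : ℝ)))
      ≤ (randomSet q).real {S | ∀ i ∈ X, 2 ≤ (↑(F i) ∩ S).ncard} :=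
    (Finset.prod_le_prod (fun _ _ => (Real.exp_pos _).le)
      fun i hi => exp_le_randomSet_real_two_le_ncard q (F i) (hF i hi)).trans
      (prod_randomSet_real_le_forall q X fun i S T hST (hS : 2 ≤ (↑(F i) ∩ S).ncard) =>
        hS.trans (Set.ncard_le_ncard (Set.inter_subset_inter_right _ hST)))
  exact mul_le_mul hmiss hhit (Finset.prod_nonneg fun _ _ => (Real.exp_pos _).le)
    ((Real.exp_pos _).le.trans hmiss)

theorem half_le_randomSet_real_forall_mem_iff_eq [Finite E] (p : E → I) {F : Finset E}
    (hF : ∑ e ∈ F, (p e : ℝ) ≤ 1 / 4) {y : E} (hy : y ∈ F) :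
    (p y : ℝ) / 2 ≤ (randomSet p).real {S | ∀ e ∈ F, e ∈ S ↔ e = y} := by
  have hmass := randomSet_real_forall_mem_iff p F {y}
  simp only [Set.mem_singleton_iff] at hmass
  have hrest : ∏ e ∈ F.erase y, (if e = y then (p e : ℝ) else 1 - p e)
      = ∏ e ∈ F.erase y, (1 - (p e : ℝ)) :=
    Finset.prod_congr rfl fun e he => if_neg (Finset.ne_of_mem_erase he)
  rw [hmass, ← Finset.mul_prod_erase _ _ hy, hrest, if_pos rfl]
  have herase : ∑ e ∈ F.erase y, (p e : ℝ) ≤ 1 / 4 :=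
    (Finset.sum_le_sum_of_subset_of_nonneg (Finset.erase_subset y F)
      fun e _ _ => (p e).2.1).trans hF
  have hle (e : E) (he : e ∈ F.erase y) : (p e : ℝ) ≤ 1 / 2 :=
    (Finset.single_le_sum (fun e _ => (p e).2.1) he).trans (by linarith)
  have hmiss := exp_neg_two_mul_sum_le_prod_one_sub hle
  have := Real.one_sub_le_exp_neg (2 * ∑ e ∈ F.erase y, (p e : ℝ))
  nlinarith [(p y).2.1]

theorem half_sum_le_randomSet_real_ncard_eq_one [Finite E] (p : E → I) (F : Finset E)
    (hF : ∑ e ∈ F, (p e : ℝ) ≤ 1 / 4) :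
    (∑ e ∈ F, (p e : ℝ)) / 2 ≤ (randomSet p).real {S | (↑F ∩ S).ncard = 1} := by
  have hunion : {S : Set E | (↑F ∩ S).ncard = 1} = ⋃ y ∈ F, {S | ∀ e ∈ F, e ∈ S ↔ e = y} := by
    ext S
    simp only [Set.mem_ofPred_eq, Set.ncard_eq_one, Set.mem_iUnion, exists_prop, Set.ext_iff,
      Set.mem_inter_iff, Finset.mem_coe, Set.mem_singleton_iff]
    exact ⟨fun ⟨y, hy⟩ => ⟨y, by grind⟩, fun ⟨y, hyF, hy⟩ => ⟨y, by grind⟩⟩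
  have hdisj : (F : Set E).PairwiseDisjoint fun y => {S : Set E | ∀ e ∈ F, e ∈ S ↔ e = y} :=
    fun y hy z _ hyz => Set.disjoint_left.2 fun S hSy hSz =>
      hyz ((hSz y hy).1 ((hSy y hy).2 rfl))
  rw [hunion, measureReal_biUnion_finset hdisj fun _ _ => .of_discrete, Finset.sum_div]
  exact Finset.sum_le_sum fun y hy => half_le_randomSet_real_forall_mem_iff_eq p hF hy

end RandomSet

section UpperBound

open scoped Classical

theorem exists_card_filter_notMem_le {V Ω : Type*} [MeasurableSpace Ω] (μ : Measure Ω)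
    [IsProbabilityMeasure μ] (X : Finset V) {R : V → Set Ω} {r : ℝ}
    (hmeas : ∀ x ∈ X, MeasurableSet (R x)) (hR : ∀ x ∈ X, 1 - r ≤ μ.real (R x)) :
    ∃ ω, ((X.filter (ω ∉ R ·)).card : ℝ) ≤ r * X.card := by
  have hint : ∀ x ∈ X, Integrable ((R x)ᶜ.indicator (1 : Ω → ℝ)) μ := fun x hx =>
    (integrable_const 1).indicator (hmeas x hx).compl
  obtain ⟨ω, hω⟩ := exists_le_integral (integrable_finsetSum X hint)
  refine ⟨ω, ?_⟩
  have hcount : ∑ x ∈ X, (R x)ᶜ.indicator (1 : Ω → ℝ) ω = (X.filter (ω ∉ R ·)).card := by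
    simp only [Set.indicator_apply, Set.mem_compl_iff, Pi.one_apply]
    exact Finset.sum_boole _ _
  rw [← hcount]
  refine hω.trans ?_
  rw [integral_finsetSum _ hint, mul_comm, ← nsmul_eq_mul]
  refine Finset.sum_le_card_nsmul _ _ _ fun x hx => ?_
  rw [integral_indicator_one (hmeas x hx).compl, probReal_compl_eq_one_sub (hmeas x hx)]
  linarith [hR x hx]

theorem exists_finset_forall_exists_mem {V Ω : Type*} [MeasurableSpace Ω] (μ : Measure Ω)
    [IsProbabilityMeasure μ] {R : V → Set Ω} {r : ℝ} (hr : 0 ≤ r) {m : ℕ} {X : Finset V}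
    (hmeas : ∀ x ∈ X, MeasurableSet (R x)) (hR : ∀ x ∈ X, 1 - r ≤ μ.real (R x))
    (hm : r ^ m * X.card < 1) :
    ∃ 𝒮 : Finset Ω, 𝒮.card ≤ m ∧ ∀ x ∈ X, ∃ ω ∈ 𝒮, ω ∈ R x := by
  induction m generalizing X with
  | zero =>
    have hX : X = ∅ := by
      rw [pow_zero, one_mul, Nat.cast_lt_one, Finset.card_eq_zero] at hm
      exact hm
    exact ⟨∅, le_rfl, by simp [hX]⟩
  | succ m ih =>
    obtain ⟨ω, hω⟩ := exists_card_filter_notMem_le μ X hmeas hR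
    have hm' : r ^ m * (X.filter (ω ∉ R ·)).card < 1 := by
      refine (mul_le_mul_of_nonneg_left hω (by positivity)).trans_lt ?_
      rwa [← mul_assoc, ← pow_succ]
    obtain ⟨𝒮, hcard, h𝒮⟩ := ih (fun x hx => hmeas x (Finset.mem_of_mem_filter x hx))
      (fun x hx => hR x (Finset.mem_of_mem_filter x hx)) hm'
    refine ⟨insert ω 𝒮, (Finset.card_insert_le _ _).trans (by omega), fun x hx => ?_⟩
    by_cases hxω : ω ∈ R x
    · exact ⟨ω, Finset.mem_insert_self _ _, hxω⟩
    · obtain ⟨ω', hω', hxω'⟩ := h𝒮 x (Finset.mem_filter.2 ⟨hx, hxω⟩)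
      exact ⟨ω', Finset.mem_insert_of_mem hω', hxω'⟩

/-- A random set of density `2 ^ -(i + 3)` hits each `D x` exactly once with probability at least
`1 / 16`. -/
theorem exists_finset_ncard_inter_eq_one_of_dyadic {V E : Type*} [Finite E] (i : ℕ) (X : Finset V)
    (D : V → Set E) (hlow : ∀ x ∈ X, 2 ^ i ≤ (D x).ncard)
    (hupp : ∀ x ∈ X, (D x).ncard < 2 ^ (i + 1))
    {m : ℕ} (hm : (15 / 16 : ℝ) ^ m * X.card < 1) :
    ∃ 𝒮 : Finset (Set E), 𝒮.card ≤ m ∧ ∀ x ∈ X, ∃ S ∈ 𝒮, (D x ∩ S).ncard = 1 := by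
  have := Fintype.ofFinite E
  let p : I := ⟨(1 / 2) ^ (i + 3), by positivity, pow_le_one₀ (by norm_num) (by norm_num)⟩
  refine exists_finset_forall_exists_mem (randomSet fun _ : E => p) (r := 15 / 16) (by norm_num)
    (R := fun x => {S | (D x ∩ S).ncard = 1}) (fun _ _ => .of_discrete) (fun x hx => ?_) hm
  have hsum : ∑ _e ∈ (D x).toFinset, (p : ℝ) = (D x).ncard * (1 / 2) ^ (i + 3) := by
    rw [Finset.sum_const, nsmul_eq_mul, Set.ncard_eq_toFinset_card']
  have hpow : (2 : ℝ) ^ i * (1 / 2) ^ (i + 3) = 1 / 8 := by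
    rw [pow_add, ← mul_assoc, ← mul_pow]
    norm_num
  have hlow' : (2 : ℝ) ^ i ≤ (D x).ncard := mod_cast hlow x hx
  have hupp' : ((D x).ncard : ℝ) ≤ 2 ^ i * 2 := mod_cast (hupp x hx).le
  have hpos : (0 : ℝ) < (1 / 2) ^ (i + 3) := by positivity
  have key := half_sum_le_randomSet_real_ncard_eq_one (fun _ => p) (D x).toFinset
    (by rw [hsum]; nlinarith)
  rw [hsum, Set.coe_toFinset] at key
  nlinarith

theorem exists_finset_ncard_inter_eq_one {V E : Type*} [Fintype V] [Fintype E] (D : V → Set E)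
    (hD : ∀ x, (D x).Nonempty) {m : ℕ} (hm : (15 / 16 : ℝ) ^ m * Fintype.card V < 1) :
    ∃ 𝒮 : Finset (Set E), 𝒮.card ≤ (Nat.log 2 (Fintype.card E) + 1) * m ∧
      ∀ x, ∃ S ∈ 𝒮, (D x ∩ S).ncard = 1 := by
  let X (i : ℕ) : Finset V := Finset.univ.filter fun x => Nat.log 2 (D x).ncard = i
  have hne (x : V) : (D x).ncard ≠ 0 := ((hD x).ncard_pos).ne'
  have hscale (i : ℕ) : ∃ 𝒮 : Finset (Set E), 𝒮.card ≤ m ∧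
      ∀ x ∈ X i, ∃ S ∈ 𝒮, (D x ∩ S).ncard = 1 := by
    refine exists_finset_ncard_inter_eq_one_of_dyadic i (X i) D (fun x hx => ?_) (fun x hx => ?_)
      ((mul_le_mul_of_nonneg_left (mod_cast Finset.card_le_univ _) (by positivity)).trans_lt hm)
    · rw [← (Finset.mem_filter.1 hx).2]
      exact Nat.pow_log_le_self 2 (hne x)
    · rw [← (Finset.mem_filter.1 hx).2]
      exact Nat.lt_pow_succ_log_self one_lt_two _
  choose 𝒮 hcard h𝒮 using hscale
  refine ⟨(Finset.range (Nat.log 2 (Fintype.card E) + 1)).biUnion 𝒮, ?_, fun x => ?_⟩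
  · exact (Finset.card_biUnion_le_card_mul _ 𝒮 m fun i _ => hcard i).trans_eq
      (by rw [Finset.card_range])
  · obtain ⟨S, hS, hx⟩ := h𝒮 (Nat.log 2 (D x).ncard) x (by simp [X])
    refine ⟨S, Finset.mem_biUnion.2 ⟨_, Finset.mem_range.2 (Nat.lt_succ_of_le ?_), hS⟩, hx⟩
    refine Nat.log_mono_right ?_
    rw [← Nat.card_eq_fintype_card]
    exact Set.ncard_le_card _

theorem nat_log_two_add_one_mul_le {n : ℕ} (hn : 3 ≤ n) :
    ((Nat.log 2 n + 1 : ℕ) : ℝ) * (⌊16 * Real.log n⌋₊ + 1 : ℕ) ≤ 50 * Real.log n ^ 2 := by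
  have hone : 1 ≤ Real.log n := by
    rw [Real.le_log_iff_exp_le (by positivity)]
    exact Real.exp_one_lt_three.le.trans (mod_cast hn)
  have hlog : (Nat.log 2 n : ℝ) * Real.log 2 ≤ Real.log n := by
    rw [← Real.log_pow]
    exact Real.log_le_log (by positivity) (mod_cast Nat.pow_log_le_self 2 (by omega))
  have hlog' : (Nat.log 2 n : ℝ) ≤ 3 / 2 * Real.log n := by
    nlinarith [Real.log_two_gt_d9, (Nat.log 2 n).cast_nonneg (α := ℝ)]
  have hfloor := Nat.floor_le (by positivity : 0 ≤ 16 * Real.log n)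
  calc ((Nat.log 2 n + 1 : ℕ) : ℝ) * (⌊16 * Real.log n⌋₊ + 1 : ℕ)
      ≤ (5 / 2 * Real.log n) * (17 * Real.log n) := by
        push_cast
        gcongr <;> linarith
    _ ≤ 50 * Real.log n ^ 2 := by nlinarith

theorem exists_finset_card_le_log_sq {n : ℕ} (hn : 3 ≤ n) (D : Fin n → Set (Fin n))
    (hD : ∀ x, (D x).Nonempty) :
    ∃ 𝒮 : Finset (Set (Fin n)), 𝒮.card ≤ ⌊50 * Real.log n ^ 2⌋₊ ∧
      ∀ x, ∃ S ∈ 𝒮, (D x ∩ S).ncard = 1 := by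
  obtain ⟨𝒮, hcard, h𝒮⟩ := exists_finset_ncard_inter_eq_one D hD
    (m := ⌊16 * Real.log n⌋₊ + 1) (by
      rw [Fintype.card_fin]
      have hfloor := Nat.lt_floor_add_one (16 * Real.log n)
      have hlt := pow_mul_one_sub_pow_lt_one (n := n) (k := 1) (m := ⌊16 * Real.log n⌋₊ + 1)
        (δ := 1 / 16) (by omega) (by norm_num) (by push_cast; linarith)
      rw [pow_one, mul_comm] at hlt
      convert hlt
      norm_num)
  rw [Fintype.card_fin] at hcard
  exact ⟨𝒮, hcard.trans (Nat.le_floor (mod_cast nat_log_two_add_one_mul_le hn)), h𝒮⟩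

theorem chiCFOpen_le {n : ℕ} (hn : 3 ≤ n) : (chiCFOpen n : ℝ) ≤ 50 * Real.log n ^ 2 := by
  have hmem : ⌊50 * Real.log n ^ 2⌋₊ ∈ openCFBounds n := fun G hG =>
    exists_finset_card_le_log_sq hn (fun x => G.neighborSet x) hG
  exact (Nat.cast_le.2 ((chiCFOpen_isLeast n).2 hmem)).trans (Nat.floor_le (by positivity))

theorem chiCFClosed_le {n : ℕ} (hn : 3 ≤ n) : (chiCFClosed n : ℝ) ≤ 50 * Real.log n ^ 2 := by
  have hmem : ⌊50 * Real.log n ^ 2⌋₊ ∈ closedCFBounds n := fun G =>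
    exists_finset_card_le_log_sq hn (fun x => insert x (G.neighborSet x))
      fun x => Set.insert_nonempty _ _
  exact (Nat.cast_le.2 ((chiCFClosed_isLeast n).2 hmem)).trans (Nat.floor_le (by positivity))

end UpperBound

section Absorption

open scoped Classical

variable {V ι : Type*} [Fintype ι] {F : ι → Finset V}

/-- The indices of the sets `F j` contained in `U`; the absorption procedure enlarges `U` until no
further `F j` can be added to it cheaply. -/
noncomputable def absorbed (F : ι → Finset V) (U : Finset V) : Finset ι :=
  Finset.univ.filter fun j => F j ⊆ U

theorem mem_absorbed {U : Finset V} {j : ι} : j ∈ absorbed F U ↔ F j ⊆ U := by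
  simp [absorbed]

theorem card_absorbed_lt_card_absorbed_union {U : Finset V} {j : ι} (hj : ¬ F j ⊆ U) :
    (absorbed F U).card < (absorbed F (U ∪ F j)).card := by
  refine Finset.card_lt_card (Finset.ssubset_iff_subset_ne.2 ⟨fun k hk => ?_, fun h => hj ?_⟩)
  · exact mem_absorbed.2 ((mem_absorbed.1 hk).trans Finset.subset_union_left)
  · exact mem_absorbed.1 (h ▸ mem_absorbed.2 Finset.subset_union_right)

theorem exists_absorbing_superset (w : V → ℝ) (F : ι → Finset V) {θ : ℝ} (hθ : 0 ≤ θ)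
    (U : Finset V) :
    ∃ U', U ⊆ U' ∧ (∀ j, F j ⊆ U' ∨ θ < ∑ y ∈ F j \ U', w y) ∧
      ∑ y ∈ U', w y ≤ ∑ y ∈ U, w y + θ * ((absorbed F U').card - (absorbed F U).card) := by
  by_cases! hU : ∀ j, F j ⊆ U ∨ θ < ∑ y ∈ F j \ U, w y
  · exact ⟨U, subset_rfl, hU, by simp⟩
  obtain ⟨j, hjU, hjθ⟩ := hU
  obtain ⟨U', hU', hsep, hcost⟩ := exists_absorbing_superset w F hθ (U ∪ F j)
  refine ⟨U', Finset.subset_union_left.trans hU', hsep, ?_⟩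
  have hsum : ∑ y ∈ U ∪ F j, w y = ∑ y ∈ U, w y + ∑ y ∈ F j \ U, w y := by
    rw [← Finset.sum_union Finset.disjoint_sdiff, Finset.union_sdiff_self_eq_union]
  have hcard : ((absorbed F U).card : ℝ) + 1 ≤ (absorbed F (U ∪ F j)).card := by
    exact_mod_cast card_absorbed_lt_card_absorbed_union hjU
  rw [hsum] at hcost
  nlinarith
termination_by Fintype.card ι - (absorbed F U).card
decreasing_by
  have := card_absorbed_lt_card_absorbed_union hjU
  have := Finset.card_le_univ (absorbed F (U ∪ F j))
  omega

theorem exists_absorbing_chain (w : V → ℝ) (F : ι → Finset V) {θ : ℕ → ℝ} (hθ : ∀ i, 0 ≤ θ i) :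
    ∃ U : ℕ → Finset V, U 0 = ∅ ∧ Monotone U ∧
      (∀ i j, F j ⊆ U (i + 1) ∨ θ i < ∑ y ∈ F j \ U (i + 1), w y) ∧
      ∀ i, ∑ y ∈ U (i + 1), w y ≤ ∑ y ∈ U i, w y
        + θ i * ((absorbed F (U (i + 1))).card - (absorbed F (U i)).card) := by
  choose next hsub hsep hcost using fun i => exists_absorbing_superset w F (hθ i)
  let U (i : ℕ) : Finset V := Nat.rec ∅ next i
  exact ⟨U, rfl, monotone_nat_of_le_succ fun i => hsub i (U i), fun i => hsep i (U i),
    fun i => hcost i (U i)⟩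

theorem sum_div_two_pow_le {K : ℝ} {W a : ℕ → ℝ}
    (hW : ∀ i, W (i + 1) ≤ W i + K * 2 ^ i * (a (i + 1) - a i)) (l : ℕ) :
    ∑ i ∈ Finset.range l, W (i + 1) / 2 ^ i + 2 * (W l / 2 ^ l)
      ≤ 2 * (W 0 + K * (a l - a 0)) := by
  induction l with
  | zero => simp
  | succ l ih =>
    have hstep : W (l + 1) / 2 ^ l ≤ W l / 2 ^ l + K * (a (l + 1) - a l) := by
      rw [div_le_iff₀ (by positivity), add_mul, div_mul_cancel₀ _ (by positivity)]
      linarith [hW l]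
    have hhalf : W (l + 1) / 2 ^ (l + 1) = W (l + 1) / 2 ^ l / 2 := by rw [pow_succ, div_div]
    rw [Finset.sum_range_succ, hhalf]
    linarith

/-- The terms with `r i = 0` are meant to contribute nothing, as division by zero has them do. -/
theorem sum_mul_two_pow_div_le_two {K : ℝ} (hK : 0 ≤ K) {r : ℕ → ℝ} (hr : Antitone r)
    (h : ∀ i, r i = 0 ∨ K * 2 ^ i < r i) (l : ℕ) :
    ∑ i ∈ Finset.range l, K * 2 ^ i / r i ≤ 2 := by
  induction l with
  | zero => simp
  | succ l ih =>
    obtain hl | hl := h l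
    · simpa [Finset.sum_range_succ, hl] using ih
    have hpos : 0 < r l := lt_of_le_of_lt (by positivity) hl
    calc ∑ i ∈ Finset.range (l + 1), K * 2 ^ i / r i
        ≤ ∑ i ∈ Finset.range (l + 1), K * 2 ^ i / r l := by
          gcongr with i hi
          exact hr (Finset.mem_range_succ_iff.1 hi)
      _ = K * (2 ^ (l + 1) - 1) / r l := by
          rw [← Finset.sum_div, ← Finset.mul_sum, geom_sum_eq (by norm_num)]
          norm_num
      _ ≤ 2 := by
          rw [div_le_iff₀ hpos, pow_succ]
          linarith

/-- The sets absorbed at scale `i` pay for the weight of `U`, and each of the others meets the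
geometrically growing thresholds, so the costs of all scales together are `O(|ι|)`. A set contained
in `U` has no cost: its term in the last sum is a division by zero. -/
theorem exists_separating_scale {w : V → ℝ} (hw : ∀ y, 0 ≤ w y) (F : ι → Finset V) {L : ℕ}
    (hL : 0 < L) :
    ∃ i < L, ∃ U : Finset V, (∀ j, F j ⊆ U ∨ 16 * 2 ^ i < ∑ y ∈ F j \ U, w y) ∧
      (∑ y ∈ U, w y) / 2 ^ i + ∑ j, 16 * 2 ^ i / ∑ y ∈ F j \ U, w y
        ≤ 34 * Fintype.card ι / L := by
  obtain ⟨U, hU0, hmono, hsep, hcost⟩ :=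
    exists_absorbing_chain w F (θ := fun i => 16 * 2 ^ i) fun i => by positivity
  have hlight : ∑ i ∈ Finset.range L, (∑ y ∈ U (i + 1), w y) / 2 ^ i
      ≤ 32 * Fintype.card ι := by
    have hsum := sum_div_two_pow_le (W := fun i => ∑ y ∈ U i, w y)
      (a := fun i => (absorbed F (U i)).card) hcost L
    have hnonneg : 0 ≤ (∑ y ∈ U L, w y) / 2 ^ L :=
      div_nonneg (Finset.sum_nonneg fun y _ => hw y) (by positivity)
    have hcard : ((absorbed F (U L)).card : ℝ) ≤ Fintype.card ι := by
      exact_mod_cast Finset.card_le_univ _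
    have hcard0 : (0 : ℝ) ≤ (absorbed F (U 0)).card := Nat.cast_nonneg _
    simp only [hU0, Finset.sum_empty] at hsum hcard0
    linarith
  have hheavy (j : ι) : ∑ i ∈ Finset.range L, 16 * 2 ^ i / ∑ y ∈ F j \ U (i + 1), w y ≤ 2 := by
    refine sum_mul_two_pow_div_le_two (by norm_num) (antitone_nat_of_succ_le fun i => ?_)
      (fun i => (hsep i j).imp_left fun h => ?_) L
    · exact Finset.sum_le_sum_of_subset_of_nonneg
        (Finset.sdiff_subset_sdiff subset_rfl (hmono (i + 1).le_succ)) fun y _ _ => hw y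
    · rw [Finset.sdiff_eq_empty_iff_subset.2 h, Finset.sum_empty]
  have htotal : ∑ i ∈ Finset.range L, ((∑ y ∈ U (i + 1), w y) / 2 ^ i
      + ∑ j, 16 * 2 ^ i / ∑ y ∈ F j \ U (i + 1), w y)
      ≤ ∑ _i ∈ Finset.range L, (34 * Fintype.card ι / L : ℝ) := by
    have hheavy' := Finset.sum_le_sum fun j (_ : j ∈ Finset.univ) => hheavy j
    rw [Finset.sum_const, Finset.card_univ, nsmul_eq_mul] at hheavy'
    rw [Finset.sum_add_distrib, Finset.sum_comm (t := Finset.univ), Finset.sum_const,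
      Finset.card_range, nsmul_eq_mul, mul_div_cancel₀ _ (by positivity)]
    linarith
  obtain ⟨i, hi, hle⟩ := Finset.exists_le_of_sum_le ⟨0, Finset.mem_range.2 hL⟩ htotal
  exact ⟨i, Finset.mem_range.1 hi, U (i + 1), hsep i, hle⟩

end Absorption

section RandomGraph

open scoped Classical

variable {V ι κ : Type*}

/-- If `T` is a subset of a set `T₀`, either all of `T₀` or of size at least `M`, then this
guarantees that `N` does not meet `T₀` in exactly one element; it is decided by `N ∩ T` alone. -/
def MissesOrHitsTwice (M : ℕ) (N T : Set V) : Prop :=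
  T.ncard < M ∧ Disjoint N T ∨ 2 ≤ (N ∩ T).ncard

theorem MissesOrHitsTwice.ncard_inter_ne_one [Finite V] {M : ℕ} {N N₀ T T₀ : Set V}
    (h : MissesOrHitsTwice M N T) (hT : T ⊆ T₀) (hT₀ : T = T₀ ∨ M ≤ T.ncard)
    (hN : N₀ ∩ T = N ∩ T) : (N₀ ∩ T₀).ncard ≠ 1 := by
  rcases h with ⟨hcard, hdisj⟩ | htwo
  · obtain rfl := hT₀.resolve_right hcard.not_ge
    simp [hN, hdisj.inter_eq]
  · have := Set.ncard_le_ncard (Set.inter_subset_inter_right N₀ hT)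
    rw [hN] at this
    omega

theorem missesOrHitsTwice_preimage_val {M : ℕ} {N T Z : Set V} (hT : T ⊆ Z) :
    MissesOrHitsTwice M (Subtype.val ⁻¹' N : Set Z) (Subtype.val ⁻¹' T)
      ↔ MissesOrHitsTwice M N T := by
  have hrange : T ⊆ Set.range (Subtype.val : Z → V) := by rwa [Subtype.range_coe]
  rw [MissesOrHitsTwice, MissesOrHitsTwice, ← Set.preimage_inter,
    Set.ncard_preimage_of_injective_subset_range Subtype.val_injective hrange,
    Set.ncard_preimage_of_injective_subset_range Subtype.val_injective
      (Set.inter_subset_right.trans hrange),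
    Set.disjoint_iff_inter_eq_empty, ← Set.preimage_inter, Set.preimage_eq_empty_iff,
    Set.disjoint_iff_inter_eq_empty, Set.disjoint_iff_inter_eq_empty,
    Set.inter_eq_left.2 (Set.inter_subset_right.trans hrange)]

/-- The probability of an edge between a vertex of colour `a` and a vertex of colour `b`: colour `a`
stands for the vertex weight `2 ^ -(a + 1)`, and edge probabilities are products of weights. -/
noncomputable def colourProb (a b : ℕ) : I :=
  ⟨(1 / 2) ^ (a + 1) * (1 / 2) ^ (b + 1), by positivity, by
    rw [← pow_add]
    exact pow_le_one₀ (by norm_num) (by norm_num)⟩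

theorem colourProb_comm (a b : ℕ) : colourProb a b = colourProb b a :=
  Subtype.ext (mul_comm _ _)

theorem colourProb_le_half (a b : ℕ) : (colourProb a b : ℝ) ≤ 1 / 2 := by
  change (1 / 2 : ℝ) ^ (a + 1) * (1 / 2) ^ (b + 1) ≤ 1 / 2
  rw [← pow_add]
  exact (pow_le_pow_of_le_one (by norm_num) (by norm_num) (by omega)).trans_eq (pow_one _)

theorem sum_colourProb (l : ℕ) (c : V → ℕ) (U : Finset V) :
    ∑ y ∈ U, (colourProb l (c y) : ℝ) = (∑ y ∈ U, (1 / 2 : ℝ) ^ (c y + 1)) / 2 ^ (l + 1) := by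
  simp only [colourProb, ← Finset.mul_sum]
  rw [one_div_pow (2 : ℝ) (l + 1), one_div_mul_eq_div]

theorem card_lt_of_sum_div_two_pow_le {w : V → ℝ} {L M i : ℕ} {C : ℝ} {U : Finset V}
    (hw : ∀ y, (1 / 2) ^ L ≤ w y) (hi : i ≤ L) (hU : (∑ y ∈ U, w y) / 2 ^ i ≤ C)
    (hM : C * 4 ^ L < M) : U.card < M := by
  have hlow : U.card * (1 / 2 : ℝ) ^ L ≤ ∑ y ∈ U, w y := by
    rw [← nsmul_eq_mul]
    exact Finset.card_nsmul_le_sum _ _ _ fun y _ => hw y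
  have hC : 0 ≤ C :=
    le_trans (div_nonneg (le_trans (by positivity) hlow) (by positivity)) hU
  have hcard : (U.card : ℝ) ≤ C * 4 ^ L := calc
    (U.card : ℝ) = U.card * (1 / 2 : ℝ) ^ L * 2 ^ L := by
      rw [mul_assoc, ← mul_pow]
      norm_num
    _ ≤ (C * 2 ^ L) * 2 ^ L := by
      refine mul_le_mul_of_nonneg_right ?_ (by positivity)
      refine hlow.trans (((div_le_iff₀ (by positivity)).1 hU).trans ?_)
      gcongr
      norm_num
    _ = C * 4 ^ L := by
      rw [mul_assoc, ← mul_pow]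
      norm_num
  exact_mod_cast hcard.trans_lt hM

/-- At the separating scale, miss the set `U` and hit each `T j` not contained in `U` twice. -/
theorem exists_scale_exp_le_randomSet_real_missesOrHitsTwice [Finite V] [Fintype ι] {c : V → ℕ}
    {L M : ℕ} (hL : 0 < L) (hc : ∀ y, c y < L) (hM : 34 * Fintype.card ι / L * 4 ^ L < (M : ℝ))
    (T : ι → Set V) :
    ∃ l < L, Real.exp (-(34 * Fintype.card ι / L))
      ≤ (randomSet fun y => colourProb l (c y)).real {N | ∀ j, MissesOrHitsTwice M N (T j)} := by
  have := Fintype.ofFinite V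
  let F (j : ι) : Finset V := (T j).toFinset
  have hw (y : V) : (0 : ℝ) ≤ (1 / 2) ^ (c y + 1) := by positivity
  obtain ⟨l, hl, U, hsep, hcost⟩ := exists_separating_scale hw F hL
  have hterm (j : ι) : 0 ≤ 16 * 2 ^ l / ∑ y ∈ F j \ U, (1 / 2 : ℝ) ^ (c y + 1) :=
    div_nonneg (by positivity) (Finset.sum_nonneg fun y _ => hw y)
  have hUcard : U.card < M :=
    card_lt_of_sum_div_two_pow_le
      (fun y => pow_le_pow_of_le_one (by norm_num) (by norm_num) (hc y)) hl.le
      ((le_add_of_nonneg_right (Finset.sum_nonneg fun j _ => hterm j)).trans hcost) hM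
  have hhit := exp_le_randomSet_real_disjoint_and_hits (fun y => colourProb l (c y))
    (fun y => colourProb_le_half l (c y)) U (Finset.univ.filter fun j => ¬ F j ⊆ U) F fun j hj => by
      rw [sum_colourProb, le_div_iff₀ (by positivity), pow_succ]
      linarith [(hsep j).resolve_left (Finset.mem_filter.1 hj).2]
  have hexponent : 2 * ∑ y ∈ U, (colourProb l (c y) : ℝ)
      + ∑ j with ¬ F j ⊆ U, 8 / ∑ y ∈ F j \ U, (colourProb l (c y) : ℝ)
      ≤ 34 * Fintype.card ι / L := by
    refine le_trans (add_le_add (le_of_eq ?_) ?_) hcost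
    · rw [sum_colourProb, pow_succ]
      ring
    · refine (Finset.sum_le_sum fun j _ => le_of_eq ?_).trans
        (Finset.sum_le_univ_sum_of_nonneg hterm)
      rw [sum_colourProb, div_div_eq_mul_div, pow_succ]
      ring
  refine ⟨l, hl, (Real.exp_le_exp.2 (neg_le_neg hexponent)).trans (hhit.trans
    (measureReal_mono fun N ⟨hmiss, htwice⟩ j => ?_))⟩
  have hTF : T j = F j := (Set.coe_toFinset _).symm
  by_cases hj : F j ⊆ U
  · left
    rw [hTF, Set.ncard_coe_finset]
    exact ⟨(Finset.card_le_card hj).trans_lt hUcard, (hmiss.mono_left (mod_cast hj)).symm⟩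
  · right
    rw [hTF, Set.inter_comm]
    exact htwice j (by simp [hj])

/-- The edge probabilities of a random graph on vertices coloured by `c`. -/
noncomputable def edgeProb (c : V → ℕ) : Sym2 V → I :=
  Sym2.lift ⟨fun x y => colourProb (c x) (c y), fun _ _ => colourProb_comm _ _⟩

theorem injective_sym2Mk_of_disjoint {X Z : Set V} (hXZ : Disjoint X Z) :
    (fun xz : X × Z => s((xz.1 : V), (xz.2 : V))).Injective := by
  rintro ⟨x, z⟩ ⟨x', z'⟩ h
  rcases Sym2.eq_iff.1 h with ⟨hx, hz⟩ | ⟨hx, -⟩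
  · exact Prod.ext (Subtype.ext hx) (Subtype.ext hz)
  · exact absurd hx (hXZ.ne_of_mem x.2 z'.2)

/-- Distinct vertices of `X` behave independently, since they depend on disjoint sets of edges. -/
theorem exists_scale_randomSet_real_forall_not_le [Finite V] [Fintype ι] {c : V → ℕ} {L M : ℕ}
    (hL : 0 < L) (hc : ∀ x, c x < L) (hM : 34 * Fintype.card ι / L * 4 ^ L < (M : ℝ))
    (T : ι → Set V) :
    ∃ l < L, ∀ X : Set V, (∀ x ∈ X, c x = l) → (∀ j, Disjoint X (T j)) →
      (randomSet (edgeProb c)).real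
        {S | ∀ x ∈ X, ¬ ∀ j, MissesOrHitsTwice M {y | s(x, y) ∈ S} (T j)}
        ≤ (1 - Real.exp (-(34 * Fintype.card ι / L))) ^ X.ncard := by
  have := Fintype.ofFinite V
  let Z : Set V := ⋃ j, T j
  let 𝒜 : Set (Set Z) := {N | ∀ j, MissesOrHitsTwice M N (Subtype.val ⁻¹' T j)}
  obtain ⟨l, hl, hprob⟩ := exists_scale_exp_le_randomSet_real_missesOrHitsTwice
    (c := fun z : Z => c z) hL (fun z => hc z) hM fun j => Subtype.val ⁻¹' T j
  refine ⟨l, hl, fun X hXl hXT => ?_⟩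
  have hslice := randomSet_real_forall_slice (edgeProb c)
    (injective_sym2Mk_of_disjoint (Set.disjoint_iUnion_right.2 hXT)) fun _ : X => 𝒜ᶜ
  have hevent : {S | ∀ x ∈ X, ¬ ∀ j, MissesOrHitsTwice M {y | s(x, y) ∈ S} (T j)}
      = {S : Set (Sym2 V) | ∀ x : X, {z : Z | s((x : V), (z : V)) ∈ S} ∈ 𝒜ᶜ} := by
    ext S
    have hpre (x : V) (j : ι) := missesOrHitsTwice_preimage_val (M := M)
      (N := {y | s(x, y) ∈ S}) (Set.subset_iUnion T j)
    simp only [Set.mem_ofPred_eq, ← hpre, Subtype.forall]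
    rfl
  have hcard : X.ncard = (Finset.univ : Finset X).card := by
    rw [← Nat.card_coe_set_eq, Nat.card_eq_fintype_card, Finset.card_univ]
  rw [hevent, hslice, hcard, ← Finset.prod_const]
  refine Finset.prod_le_prod (fun _ _ => measureReal_nonneg) fun x _ => ?_
  rw [probReal_compl_eq_one_sub .of_discrete]
  have hcolour : (fun z : Z => edgeProb c s((x : V), (z : V)))
      = fun z : Z => colourProb l (c z) :=
    funext fun z => congrArg (colourProb · (c z)) (hXl x x.2)
  rw [hcolour]
  exact sub_le_sub_left hprob 1

theorem exists_edgeSet_forall_exists_missesOrHitsTwice [Finite V] [Fintype ι] [Fintype κ]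
    {c : V → ℕ} {L M m : ℕ} (hL : 0 < L) (hc : ∀ x, c x < L)
    (hM : 34 * Fintype.card ι / L * 4 ^ L < (M : ℝ)) {T : κ → ι → Set V} {B : κ → Set V}
    (hTB : ∀ k j, T k j ⊆ B k) (hm : ∀ k, ∀ l < L, m + (B k).ncard ≤ (c ⁻¹' {l}).ncard)
    (hlt : Fintype.card κ * (1 - Real.exp (-(34 * Fintype.card ι / L))) ^ m < 1) :
    ∃ S : Set (Sym2 V), ∀ k, ∃ x ∉ B k, ∀ j, MissesOrHitsTwice M {y | s(x, y) ∈ S} (T k j) := by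
  choose l hl hprob using fun k => exists_scale_randomSet_real_forall_not_le hL hc hM (T k)
  set q := 1 - Real.exp (-(34 * Fintype.card ι / L))
  have hq0 : 0 ≤ q := sub_nonneg.2 (Real.exp_le_one_iff.2 (neg_nonpos.2 (by positivity)))
  have hq1 : q ≤ 1 := sub_le_self _ (Real.exp_pos _).le
  let bad (k : κ) : Set (Set (Sym2 V)) :=
    {S | ∀ x ∈ c ⁻¹' {l k} \ B k, ¬ ∀ j, MissesOrHitsTwice M {y | s(x, y) ∈ S} (T k j)}
  have hbad (k : κ) : (randomSet (edgeProb c)).real (bad k) ≤ q ^ m := by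
    refine (hprob k _ (fun x hx => hx.1)
      fun j => Set.disjoint_sdiff_left.mono_right (hTB k j)).trans ?_
    refine pow_le_pow_of_le_one hq0 hq1 ?_
    have := Set.le_ncard_sdiff (B k) (c ⁻¹' {l k})
    have := hm k (l k) (hl k)
    omega
  have hunion : (randomSet (edgeProb c)).real (⋃ k, bad k) < 1 := by
    refine (measureReal_iUnion_fintype_le bad).trans_lt (lt_of_le_of_lt ?_ hlt)
    rw [← nsmul_eq_mul, ← Finset.card_univ]
    exact Finset.sum_le_card_nsmul _ _ _ fun k _ => hbad k
  obtain ⟨S, hS⟩ : ∃ S, S ∉ ⋃ k, bad k := by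
    by_contra! hall
    rw [Set.eq_univ_of_forall hall, probReal_univ] at hunion
    exact lt_irrefl _ hunion
  refine ⟨S, fun k => ?_⟩
  have hk : ¬ ∀ x ∈ c ⁻¹' {l k} \ B k, ¬ ∀ j, MissesOrHitsTwice M {y | s(x, y) ∈ S} (T k j) :=
    fun h => hS (Set.mem_iUnion.2 ⟨k, h⟩)
  push Not at hk
  obtain ⟨x, hx, hgood⟩ := hk
  exact ⟨x, hx.2, hgood⟩

theorem exists_range_subset [Finite V] {M : ℕ} (hM : 0 < M) {T : Set V} (hT : T.Nonempty) :
    ∃ f : Fin M → V, Set.range f ⊆ T ∧ (Set.range f = T ∨ M ≤ (Set.range f).ncard) := by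
  obtain ⟨T', hT'T, hcard⟩ := Set.exists_subset_card_eq (min_le_right M T.ncard)
  have hpos : 0 < T'.ncard := hcard ▸ lt_min hM ((Set.ncard_pos).2 hT)
  have : Nonempty T' := ((Set.ncard_pos).1 hpos).to_subtype
  obtain ⟨e⟩ : Nonempty (T' ↪ Fin M) := by
    have := Fintype.ofFinite T'
    refine Function.Embedding.nonempty_of_card_le ?_
    rw [← Nat.card_eq_fintype_card, Nat.card_coe_set_eq, Fintype.card_fin, hcard]
    exact min_le_left _ _
  have hrange : Set.range (fun k => ((Function.invFun e k : T') : V)) = T' := by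
    rw [Set.range_comp' Subtype.val, (Function.invFun_surjective e.injective).range_eq,
      Set.image_univ, Subtype.range_coe]
  refine ⟨_, hrange.symm ▸ hT'T, ?_⟩
  rw [hrange]
  rcases min_choice M T.ncard with h | h
  · exact Or.inr (hcard.trans h).ge
  · exact Or.inl (Set.eq_of_subset_of_ncard_le hT'T (hcard.trans h).ge)

theorem exists_forall_mem_exists_range_subset [Finite V] [Nonempty V] {t M : ℕ} (hM : 0 < M)
    {𝓕 : Finset (Set V)} (h𝓕 : 𝓕.card ≤ t) :
    ∃ f : Fin t → Fin M → V, ∀ T ∈ 𝓕, T.Nonempty →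
      ∃ j, Set.range (f j) ⊆ T ∧ (Set.range (f j) = T ∨ M ≤ (Set.range (f j)).ncard) := by
  choose! g hg using fun T : Set V => exists_range_subset (T := T) hM
  obtain ⟨e⟩ : Nonempty (𝓕 ↪ Fin t) := Function.Embedding.nonempty_of_card_le (by simpa using h𝓕)
  refine ⟨Function.extend e (fun T => g T) fun _ => g ∅, fun T hT hne => ⟨e ⟨T, hT⟩, ?_⟩⟩
  rw [e.injective.extend_apply]
  exact hg T hne

theorem ncard_biUnion_insert_neighborSet_le [Finite V] {H : SimpleGraph V} {d : ℕ}
    (hH : ∀ x, (H.neighborSet x).ncard ≤ d) (Z : Set V) :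
    (⋃ z ∈ Z, insert z (H.neighborSet z)).ncard ≤ Z.ncard * (d + 1) := by
  have := Fintype.ofFinite V
  have hcoe : (⋃ z ∈ Z, insert z (H.neighborSet z))
      = ↑(Z.toFinset.biUnion fun z => (insert z (H.neighborSet z)).toFinset) := by
    simp
  rw [hcoe, Set.ncard_coe_finset, Set.ncard_eq_toFinset_card' Z]
  refine Finset.card_biUnion_le_card_mul _ _ _ fun z _ => ?_
  rw [← Set.ncard_eq_toFinset_card']
  exact (Set.ncard_insert_le z _).trans (Nat.add_le_add_right (hH z) 1)

theorem neighborSet_fromEdgeSet_sup_inter {H : SimpleGraph V} {S : Set (Sym2 V)} {T : Set V} {x : V}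
    (hx : ∀ z ∈ T, x ∉ insert z (H.neighborSet z)) :
    (SimpleGraph.fromEdgeSet S ⊔ H).neighborSet x ∩ T = {y | s(x, y) ∈ S} ∩ T ∧
      insert x ((SimpleGraph.fromEdgeSet S ⊔ H).neighborSet x) ∩ T = {y | s(x, y) ∈ S} ∩ T := by
  have hne (z : V) (hz : z ∈ T) : x ≠ z ∧ ¬ H.Adj x z := by
    simpa [SimpleGraph.adj_comm] using hx z hz
  constructor <;> ext y <;>
    simp only [Set.mem_inter_iff, Set.mem_insert_iff, SimpleGraph.mem_neighborSet,
      SimpleGraph.sup_adj, SimpleGraph.fromEdgeSet_adj, Set.mem_ofPred_eq] <;>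
    grind

theorem exists_graph_forall_family_exists_ncard_inter_ne_one [Fintype V] [Nonempty V]
    {H : SimpleGraph V} {d : ℕ} (hH : ∀ x, (H.neighborSet x).ncard ≤ d) {c : V → ℕ} {L t M m : ℕ}
    (hL : 0 < L) (hc : ∀ x, c x < L) (hM : 34 * t / L * 4 ^ L < (M : ℝ))
    (hm : ∀ l < L, m + t * M * (d + 1) ≤ (c ⁻¹' {l}).ncard)
    (hlt : (Fintype.card V : ℝ) ^ (t * M) * (1 - Real.exp (-(34 * t / L))) ^ m < 1) :
    ∃ G ≥ H, ∀ 𝓕 : Finset (Set V), 𝓕.card ≤ t → ∃ x, ∀ T ∈ 𝓕,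
      (G.neighborSet x ∩ T).ncard ≠ 1 ∧ (insert x (G.neighborSet x) ∩ T).ncard ≠ 1 := by
  have hM0 : 0 < M := by
    exact_mod_cast lt_of_le_of_lt (by positivity : (0 : ℝ) ≤ 34 * t / L * 4 ^ L) hM
  let Z (f : Fin t → Fin M → V) : Set V := ⋃ j, Set.range (f j)
  have hZ (f : Fin t → Fin M → V) : (Z f).ncard ≤ t * M := by
    have hrange : Z f = Set.range fun jk : Fin t × Fin M => f jk.1 jk.2 := by
      ext y
      simp [Z]
    rw [hrange, ← Set.image_univ]
    exact (Set.ncard_image_le).trans (by simp)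
  obtain ⟨S, hS⟩ := exists_edgeSet_forall_exists_missesOrHitsTwice
    (T := fun (f : Fin t → Fin M → V) j => Set.range (f j))
    (B := fun f => ⋃ z ∈ Z f, insert z (H.neighborSet z)) hL hc (by simpa using hM)
    (fun f j y hy => Set.mem_biUnion (Set.mem_iUnion_of_mem j hy) (Set.mem_insert y _))
    (fun f l hl => (Nat.add_le_add_left ((ncard_biUnion_insert_neighborSet_le hH (Z f)).trans
      (Nat.mul_le_mul_right _ (hZ f))) m).trans (hm l hl))
    (by simpa [← pow_mul, mul_comm M t] using hlt)
  refine ⟨SimpleGraph.fromEdgeSet S ⊔ H, le_sup_right, fun 𝓕 h𝓕 => ?_⟩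
  obtain ⟨f, hf⟩ := exists_forall_mem_exists_range_subset hM0 h𝓕
  obtain ⟨x, hxB, hx⟩ := hS f
  refine ⟨x, fun T hT => ?_⟩
  obtain rfl | hne := T.eq_empty_or_nonempty
  · simp
  obtain ⟨j, hsub, hfull⟩ := hf T hT hne
  obtain ⟨hopen, hclosed⟩ := neighborSet_fromEdgeSet_sup_inter (H := H) (S := S)
    fun z hz hxz => hxB (Set.mem_biUnion (Set.mem_iUnion_of_mem j hz) hxz)
  exact ⟨(hx j).ncard_inter_ne_one hsub hfull hopen, (hx j).ncard_inter_ne_one hsub hfull hclosed⟩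

end RandomGraph

section LowerBound

theorem ncard_neighborSet_cycleGraph {n : ℕ} (hn : 3 ≤ n) (x : Fin n) :
    ((SimpleGraph.cycleGraph n).neighborSet x).ncard = 2 := by
  obtain ⟨k, rfl⟩ := Nat.exists_eq_add_of_le' hn
  rw [← SimpleGraph.cycleGraph_degree_three_le (v := x), Set.ncard_eq_toFinset_card']
  exact (SimpleGraph.cycleGraph (k + 3)).card_neighborFinset_eq_degree x

theorem div_le_ncard_preimage_mod (n : ℕ) {L i : ℕ} (hi : i < L) :
    n / L ≤ ((fun x : Fin n => (x : ℕ) % L) ⁻¹' {i}).ncard := by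
  have hlt (k : Fin (n / L)) : k * L + i < n :=
    calc k * L + i < (k + 1) * L := by rw [add_mul, one_mul]; omega
      _ ≤ n / L * L := Nat.mul_le_mul_right L k.2
      _ ≤ n := Nat.div_mul_le_self n L
  let e : Fin (n / L) → Fin n := fun k => ⟨k * L + i, hlt k⟩
  have he : e.Injective := fun k k' h => by
    have h' : (k : ℕ) * L + i = k' * L + i := congrArg Fin.val h
    exact Fin.ext (Nat.eq_of_mul_eq_mul_right (by omega) (Nat.add_right_cancel h'))
  calc n / L = (Set.range e).ncard := by simp [Set.ncard_range_of_injective he]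
    _ ≤ _ := Set.ncard_le_ncard (by rintro _ ⟨k, rfl⟩; simp [e, Nat.mod_eq_of_lt hi])

theorem log_le_of_lt_two_pow {n L : ℕ} (hn : 0 < n) (hL : 0 < L) (hlt : n < 2 ^ (20 * (L + 1))) :
    Real.log n ≤ 40 * L := by
  have hle : Real.log n ≤ Real.log (2 ^ (20 * (L + 1))) :=
    Real.log_le_log (by positivity) (mod_cast hlt.le)
  rw [Real.log_pow] at hle
  push_cast at hle
  have hL' : (1 : ℝ) ≤ L := mod_cast hL
  calc Real.log n ≤ 20 * (L + 1) * Real.log 2 := hle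
    _ ≤ 20 * (L + L) * 1 := by
      gcongr
      exact Real.log_two_lt_d9.le.trans (by norm_num)
    _ = 40 * L := by ring

theorem mul_div_le_half {L t : ℕ} (hL : 0 < L) (ht : 100 * t ≤ L ^ 2) :
    34 * (t : ℝ) / L ≤ L / 2 := by
  have ht' : 100 * (t : ℝ) ≤ L ^ 2 := mod_cast ht
  rw [div_le_iff₀ (mod_cast hL)]
  nlinarith

theorem one_div_two_pow_le_exp_neg {a : ℝ} {L : ℕ} (ha : a ≤ L / 2) :
    1 / (2 : ℝ) ^ L ≤ Real.exp (-a) := by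
  rw [one_div, ← Real.exp_log (by positivity : (0 : ℝ) < 2 ^ L), ← Real.exp_neg,
    Real.log_pow, Real.exp_le_exp]
  nlinarith [Real.log_two_gt_d9, L.cast_nonneg (α := ℝ)]

theorem mul_four_pow_lt {a : ℝ} {L : ℕ} (ha : a ≤ L / 2) : a * 4 ^ L < ((2 ^ L) ^ 3 : ℕ) := by
  have hL : (L : ℝ) < 2 ^ L := mod_cast Nat.lt_two_pow_self
  have ha' : a < 2 ^ L := by linarith [L.cast_nonneg (α := ℝ)]
  calc a * 4 ^ L < 2 ^ L * 4 ^ L := by gcongr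
    _ = ((2 ^ L) ^ 3 : ℕ) := by
      push_cast
      rw [← mul_pow, ← pow_mul, mul_comm L 3, pow_mul]
      norm_num

theorem two_pow_add_le_div {n L t : ℕ} (hL : 0 < L) (ht : 100 * t ≤ L ^ 2)
    (hn : 2 ^ (20 * L) ≤ n) : (2 ^ L) ^ 8 + t * (2 ^ L) ^ 3 * (2 + 1) ≤ n / L := by
  rw [mul_comm, pow_mul] at hn
  have hLB : L < 2 ^ L := Nat.lt_two_pow_self
  set B := 2 ^ L
  have hL2 : L ^ 2 ≤ B ^ 2 := Nat.pow_le_pow_left hLB.le 2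
  have hB : 2 ≤ B := by omega
  rw [Nat.le_div_iff_mul_le hL]
  calc (B ^ 8 + t * B ^ 3 * (2 + 1)) * L ≤ (B ^ 8 + B ^ 2 * B ^ 3) * B := by
        gcongr ?_ * ?_
        rw [mul_right_comm]
        gcongr
        omega
    _ = B ^ 9 + B ^ 6 := by ring
    _ ≤ B ^ 9 + B ^ 9 := by gcongr <;> omega
    _ ≤ B ^ 10 := by rw [pow_succ B 9]; nlinarith [Nat.zero_le (B ^ 9)]
    _ ≤ B ^ 20 := Nat.pow_le_pow_right (by omega) (by norm_num)
    _ ≤ n := hn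

theorem mul_two_pow_mul_lt {L t : ℕ} {δ ℓ : ℝ} (hL : 0 < L) (ht : 100 * t ≤ L ^ 2)
    (hδ : 1 / 2 ^ L ≤ δ) (hℓ : ℓ ≤ 40 * L) :
    ((t * (2 ^ L) ^ 3 : ℕ) : ℝ) * ℓ < ((2 ^ L) ^ 8 : ℕ) * δ := by
  have hLB : (L : ℝ) < 2 ^ L := mod_cast Nat.lt_two_pow_self
  have hL1 : (1 : ℝ) ≤ L := mod_cast hL
  have ht' : 100 * (t : ℝ) ≤ L ^ 2 := mod_cast ht
  push_cast
  set B : ℝ := 2 ^ L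
  calc t * B ^ 3 * ℓ ≤ t * B ^ 3 * (40 * L) := by gcongr
    _ = 40 * t * (B ^ 3 * L) := by ring
    _ ≤ L ^ 2 * (B ^ 3 * L) := by gcongr; linarith
    _ ≤ B ^ 2 * (B ^ 3 * B) := by gcongr
    _ = B ^ 6 := by ring
    _ < B ^ 7 := pow_lt_pow_right₀ (by linarith) (by norm_num)
    _ = B ^ 8 * (1 / B) := by field_simp
    _ ≤ B ^ 8 * δ := by gcongr

/-- Vertices are coloured by their residues modulo `L`, and adding a cycle to the random graph rules
out isolated vertices. -/
theorem exists_graph_of_two_pow_le {n L t : ℕ} (hL : 0 < L) (ht : 100 * t ≤ L ^ 2)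
    (hn : 2 ^ (20 * L) ≤ n) (hlog : Real.log n ≤ 40 * L) :
    ∃ G : SimpleGraph (Fin n), (∀ x, ∃ y, G.Adj x y) ∧ ∀ 𝓕 : Finset (Set (Fin n)), 𝓕.card ≤ t →
      ¬ IsOpenCFFamily G 𝓕 ∧ ¬ IsClosedCFFamily G 𝓕 := by
  have hn3 : 3 ≤ n :=
    calc 3 ≤ 2 ^ (20 * 1) := by norm_num
      _ ≤ 2 ^ (20 * L) := Nat.pow_le_pow_right (by norm_num) (by omega)
      _ ≤ n := hn
  have : Nonempty (Fin n) := ⟨⟨0, by omega⟩⟩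
  have ha : 34 * (t : ℝ) / L ≤ L / 2 := mul_div_le_half hL ht
  have hδ : Real.exp (-(34 * (t : ℝ) / L)) ≤ 1 :=
    Real.exp_le_one_iff.2 (neg_nonpos.2 (by positivity))
  obtain ⟨G, hG, h𝓕⟩ := exists_graph_forall_family_exists_ncard_inter_ne_one (M := (2 ^ L) ^ 3)
    (m := (2 ^ L) ^ 8) (fun x => (ncard_neighborSet_cycleGraph hn3 x).le) hL
    (fun x => Nat.mod_lt (x : ℕ) hL) (mul_four_pow_lt ha)
    (fun l hl => (two_pow_add_le_div hL ht hn).trans (div_le_ncard_preimage_mod n hl)) (by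
      rw [Fintype.card_fin]
      exact pow_mul_one_sub_pow_lt_one (by omega) hδ
        (mul_two_pow_mul_lt hL ht (one_div_two_pow_le_exp_neg ha) hlog))
  refine ⟨G, fun x => ?_, fun 𝓕 hcard => ?_⟩
  · obtain ⟨y, hy⟩ : ((SimpleGraph.cycleGraph n).neighborSet x).Nonempty :=
      Set.nonempty_of_ncard_ne_zero (by simp [ncard_neighborSet_cycleGraph hn3 x])
    exact ⟨y, hG hy⟩
  · obtain ⟨x, hx⟩ := h𝓕 𝓕 hcard
    exact ⟨fun h => let ⟨T, hT, h1⟩ := h x; (hx T hT).1 h1,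
      fun h => let ⟨T, hT, h1⟩ := h x; (hx T hT).2 h1⟩

theorem exists_graph_forall_log_sq_le {n : ℕ} (hn : 2 ^ 20 ≤ n) :
    ∃ G : SimpleGraph (Fin n), (∀ x, ∃ y, G.Adj x y) ∧ ∀ 𝓕 : Finset (Set (Fin n)),
      IsOpenCFFamily G 𝓕 ∨ IsClosedCFFamily G 𝓕 → Real.log n ^ 2 ≤ 160000 * 𝓕.card := by
  set L := Nat.log 2 n / 20
  have hL : 0 < L := Nat.div_pos (Nat.le_log_of_pow_le (by norm_num) hn) (by norm_num)
  have hle : 2 ^ (20 * L) ≤ n :=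
    (Nat.pow_le_pow_right (by norm_num) (Nat.mul_div_le _ _)).trans
      (Nat.pow_log_le_self 2 (by omega))
  have hlt : n < 2 ^ (20 * (L + 1)) :=
    (Nat.lt_pow_succ_log_self one_lt_two n).trans_le
      (Nat.pow_le_pow_right (by norm_num) (Nat.lt_mul_div_succ _ (by norm_num)))
  have hlog : Real.log n ≤ 40 * L := log_le_of_lt_two_pow (by omega) hL hlt
  obtain ⟨G, hG, h𝓕⟩ := exists_graph_of_two_pow_le hL (Nat.mul_div_le (L ^ 2) 100) hle hlog
  refine ⟨G, hG, fun 𝓕 hCF => ?_⟩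
  have hcard : L ^ 2 / 100 < 𝓕.card := by
    by_contra! hcard
    exact hCF.elim (h𝓕 𝓕 hcard).1 (h𝓕 𝓕 hcard).2
  have hL2 : (L : ℝ) ^ 2 ≤ 100 * 𝓕.card := by
    exact_mod_cast (by omega : L ^ 2 ≤ 100 * 𝓕.card)
  calc Real.log n ^ 2 ≤ (40 * L) ^ 2 := by gcongr
    _ = 1600 * (L : ℝ) ^ 2 := by ring
    _ ≤ 1600 * (100 * 𝓕.card) := by gcongr
    _ = 160000 * 𝓕.card := by ring

theorem log_sq_le_chiCFOpen {n : ℕ} (hn : 2 ^ 20 ≤ n) :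
    Real.log n ^ 2 ≤ 160000 * chiCFOpen n := by
  obtain ⟨G, hG, h⟩ := exists_graph_forall_log_sq_le hn
  obtain ⟨𝓕, hcard, h𝓕⟩ := (chiCFOpen_isLeast n).1 G hG
  exact (h 𝓕 (Or.inl h𝓕)).trans (by gcongr)

theorem log_sq_le_chiCFClosed {n : ℕ} (hn : 2 ^ 20 ≤ n) :
    Real.log n ^ 2 ≤ 160000 * chiCFClosed n := by
  obtain ⟨G, -, h⟩ := exists_graph_forall_log_sq_le hn
  obtain ⟨𝓕, hcard, h𝓕⟩ := (chiCFClosed_isLeast n).1 G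
  exact (h 𝓕 (Or.inr h𝓕)).trans (by gcongr)

end LowerBound

theorem isTheta_log_sq_of_bounds {χ : ℕ → ℕ} {C c : ℝ} {m k : ℕ}
    (hupper : ∀ n : ℕ, m ≤ n → (χ n : ℝ) ≤ C * Real.log n ^ 2)
    (hlower : ∀ n : ℕ, k ≤ n → Real.log n ^ 2 ≤ c * χ n) :
    (fun n : ℕ => (χ n : ℝ)) =Θ[atTop] (fun n : ℕ => Real.log (n : ℝ) ^ 2) := by
  constructor
  · refine IsBigO.of_bound C ?_
    filter_upwards [eventually_ge_atTop m] with n hn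
    rw [Real.norm_of_nonneg (Nat.cast_nonneg _), Real.norm_of_nonneg (sq_nonneg _)]
    exact hupper n hn
  · refine IsBigO.of_bound c ?_
    filter_upwards [eventually_ge_atTop k] with n hn
    rw [Real.norm_of_nonneg (Nat.cast_nonneg _), Real.norm_of_nonneg (sq_nonneg _)]
    exact hlower n hn

theorem mainTheorem4 :
    (fun n : ℕ => (chiCFOpen n : ℝ)) =Θ[atTop] (fun n : ℕ => Real.log (n : ℝ) ^ 2) ∧
    (fun n : ℕ => (chiCFClosed n : ℝ)) =Θ[atTop] (fun n : ℕ => Real.log (n : ℝ) ^ 2) :=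
  ⟨isTheta_log_sq_of_bounds (fun _ hn => chiCFOpen_le hn) fun _ hn => log_sq_le_chiCFOpen hn,
    isTheta_log_sq_of_bounds (fun _ hn => chiCFClosed_le hn) fun _ hn => log_sq_le_chiCFClosed hn⟩
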